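/- Digraphs are finite and simple (no loops, no parallel arcs); cycles are directed. Let $D_8^3(2,1)$ be the family of strongly connected digraphs on $8$ vertices that contain no cycle of length $2$ or $3$ and in which every vertex has out-degree at least $2$ and in-degree at least $1$. Let $\varphi_8^3(2,1)=\max\{|A(D)| : D\in D_8^3(2,1)\}$ be the maximum number of arcs of a member of this family, and let $\Phi_8^3(2,1)=\{D\in D_8^3(2,1) : |A(D)|=\varphi_8^3(2,1)\}$ be the set of extremal digraphs. Let $F_8$ be the digraph with vertex set $\{v_0,v_1,\dots,v_7\}$ and arc set $$A(F_8)=\bigcup_{i=0}^{3}\{(v_{2i},v_{2i+1}),(v_{2i},v_{2i+2}),(v_{2i},v_{2i+3}),(v_{2i+1},v_{2i+2}),(v_{2i+1},v_{2i+3})\},$$ with subscripts modulo $8$. Lemma 2.5. Every digraph $D\in\Phi_8^3(2,1)$ is isomorphic to $F_8$. Moreover $F_8$ itself belongs to $\Phi_8^3(2,1)$ (in particular it is strongly connected and has no cycle of length at most $3$), and it has exactly $20$ arcs. So $\Phi_8^3(2,1)$ has, up to isomorphism, the unique member $F_8$. -/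

import Mathlib

namespace ExtremalDigraph

universe u

/-- A directed cycle of length `l` in `D`: distinct vertices `y 0, …, y (l - 1)` with an arc from
each `y i` to `y (i + 1)`, indices modulo `l`. -/
def HasDirectedCycle {V : Type u} (D : Digraph V) (l : ℕ) : Prop :=
  ∃ y : ZMod l → V, Function.Injective y ∧ ∀ i : ZMod l, D.Adj (y i) (y (i + 1))

/-- `D` is `C_{≤k}`-free: it has no directed cycle of any length in `{2, …, k}`. -/
def CycleFree {V : Type u} (k : ℕ) (D : Digraph V) : Prop :=
  ∀ l : ℕ, 2 ≤ l → l ≤ k → ¬ HasDirectedCycle D l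

/-- `D` is strong: every vertex can be reached from every vertex along arcs. -/
def Strong {V : Type u} (D : Digraph V) : Prop :=
  ∀ u v : V, Relation.ReflTransGen D.Adj u v

/-- The out-degree of a vertex. -/
noncomputable def outDegree {V : Type u} (D : Digraph V) (v : V) : ℕ :=
  {u : V | D.Adj v u}.ncard

/-- The in-degree of a vertex. -/
noncomputable def inDegree {V : Type u} (D : Digraph V) (v : V) : ℕ :=
  {u : V | D.Adj u v}.ncard

/-- The number of arcs. -/
noncomputable def size {V : Type u} (D : Digraph V) : ℕ :=
  {p : V × V | D.Adj p.1 p.2}.ncard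

/-- Membership in the family `D_n^k(ξ, ζ)`: a finite simple digraph (Mathlib's `Digraph` has no
parallel arcs but allows loops, which are excluded here) on `n` vertices that is strong and
`C_{≤k}`-free, with all out-degrees at least `ξ` and all in-degrees at least `ζ`. -/
structure InFamily {V : Type u} (n k ξ ζ : ℕ) (D : Digraph V) : Prop where
  finite : Finite V
  card_eq : Nat.card V = n
  loopless : ∀ v : V, ¬ D.Adj v v
  strong : Strong D
  cycleFree : CycleFree k D
  le_outDegree : ∀ v : V, ξ ≤ outDegree D v
  le_inDegree : ∀ v : V, ζ ≤ inDegree D v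

/-- `φ_n^k(ξ, ζ)`: the maximum number of arcs of a member of `D_n^k(ξ, ζ)`, and `0` if there is no
member. Up to isomorphism all members live on the vertex set `Fin n`; there are finitely many of
these, so that the supremum is a maximum. -/
noncomputable def maxSize (n k ξ ζ : ℕ) : ℕ :=
  sSup {m : ℕ | ∃ D : Digraph (Fin n), InFamily n k ξ ζ D ∧ size D = m}

/-- Membership in `Φ_n^k(ξ, ζ)`: the extremal digraphs. -/
def IsExtremal {V : Type u} (n k ξ ζ : ℕ) (D : Digraph V) : Prop :=
  InFamily n k ξ ζ D ∧ size D = maxSize n k ξ ζ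

/-- The digraph `F_8`, with vertices `v_j` for `j` modulo `8`. -/
def F8 : Digraph (ZMod 8) where
  Adj a b := ∃ i ∈ Finset.range 4, (a, b) ∈
    ({(2 * (i : ZMod 8), 2 * (i : ZMod 8) + 1), (2 * (i : ZMod 8), 2 * (i : ZMod 8) + 2),
      (2 * (i : ZMod 8), 2 * (i : ZMod 8) + 3), (2 * (i : ZMod 8) + 1, 2 * (i : ZMod 8) + 2),
      (2 * (i : ZMod 8) + 1, 2 * (i : ZMod 8) + 3)} : Finset (ZMod 8 × ZMod 8))

end ExtremalDigraph

/-!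
The digraph `F8` is the blow-up of a directed `4`-cycle in which every vertex is replaced by a pair
of twins joined by an arc: `{v₀, v₁} → {v₂, v₃} → {v₄, v₅} → {v₆, v₇} → {v₀, v₁}`. Opposite pairs are
not joined, so every vertex has exactly two non-neighbours.

Conversely, let `D` be a member of the family on eight vertices. It has no directed cycle of length
`2` or `3`. Counting the out-, in- and non-neighbours of all vertices, `2 |A(D)|` plus the number of
ordered non-adjacent pairs is `8 · 7`. Every vertex has at least two non-neighbours
(`two_le_card_nons`), so `|A(D)| ≤ 20`, and equality means that every vertex has exactly two.

In the case of equality, every vertex `v` has an out-neighbour `σ v` whose out-neighbours are exactly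
the two non-neighbours of `v` (`exists_adj_forall_adj_iff_nonAdj`): it is a sink of the digraph
induced on the out-neighbours of `v`, which is acyclic because a directed `4`-cycle there is impossible
(`CyclicOuts.not_cyclicOuts`). Following `σ`, either a cycle of length `4` appears or the orbit
closes up to a circulant digraph on seven vertices that no arc leaves, which contradicts strong
connectivity (`exists_iterate_four_eq`). On a `4`-cycle of `σ`, the out-neighbours and the
non-neighbours of its vertices are known up to four further vertices, the twins; these are distinct,
and the arcs among them are forced by the absence of triangles and the count of non-neighbours
(`TwinCycle.nonempty_relIso_F8`).
-/

namespace ExtremalDigraph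

/-! ### Oriented digraphs without directed triangles -/

/-- The local consequences of membership in the family `D_n^3(2, 1)`, for every `n`: no loops (take
`a = b` in `asymm`), no directed cycle of length `2` or `3`, all out-degrees at least `2` and all
in-degrees at least `1`. Degrees are encoded by witnesses, so that no finiteness is needed. -/
structure Admissible {V : Type*} (D : Digraph V) : Prop where
  asymm : ∀ a b, D.Adj a b → ¬ D.Adj b a
  no_triangle : ∀ a b c, D.Adj a b → D.Adj b c → ¬ D.Adj c a
  two_out : ∀ v, ∃ a b, a ≠ b ∧ D.Adj v a ∧ D.Adj v b
  one_in : ∀ v, ∃ a, D.Adj a v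

lemma Admissible.exists_out_ne {V : Type*} {D : Digraph V} (hD : Admissible D) (x s : V) :
    ∃ w, w ≠ s ∧ D.Adj x w := by
  obtain ⟨a, b, hab, ha, hb⟩ := hD.two_out x
  by_cases h : a = s
  · exact ⟨b, fun h' => hab (h.trans h'.symm), hb⟩
  · exact ⟨a, h, ha⟩

lemma Admissible.adj_of_outs_subset_pair {V : Type*} {D : Digraph V} (hD : Admissible D) {x s t : V}
    (h : ∀ w, D.Adj x w → w = s ∨ w = t) : D.Adj x s ∧ D.Adj x t := by
  obtain ⟨a, b, hab, ha, hb⟩ := hD.two_out x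
  rcases h a ha with rfl | rfl <;> rcases h b hb with rfl | rfl
  · exact absurd rfl hab
  · exact ⟨ha, hb⟩
  · exact ⟨hb, ha⟩
  · exact absurd rfl hab

/-- Two distinct vertices not joined by an arc in either direction. -/
def NonAdj {V : Type*} (D : Digraph V) (v w : V) : Prop :=
  w ≠ v ∧ ¬ D.Adj v w ∧ ¬ D.Adj w v

/-- If every vertex of `S` has an out-neighbour in `S`, then three steps inside `S` visit four
distinct vertices, since a repetition would close a cycle of length at most `3`. -/
lemma exists_path_of_no_sink {V : Type*} {D : Digraph V} (hD : Admissible D)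
    {S : V → Prop} {o : V} (ho : S o)
    (hS : ∀ x, S x → ∃ y, S y ∧ D.Adj x y) :
    ∃ a b c, S a ∧ S b ∧ S c ∧ D.Adj o a ∧ D.Adj a b ∧ D.Adj b c ∧ o ≠ a ∧ o ≠ b ∧ o ≠ c ∧
      a ≠ b ∧ a ≠ c ∧ b ≠ c := by
  have h2 := hD.asymm
  have h3 := hD.no_triangle
  obtain ⟨a, ha, hoa⟩ := hS o ho
  obtain ⟨b, hb, hab⟩ := hS a ha
  obtain ⟨c, hc, hbc⟩ := hS b hb
  refine ⟨a, b, c, ha, hb, hc, hoa, hab, hbc, ?_, ?_, ?_, ?_, ?_, ?_⟩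
  · rintro rfl; exact h2 _ _ hoa hoa
  · rintro rfl; exact h2 _ _ hoa hab
  · rintro rfl; exact h3 _ _ _ hoa hab hbc
  · rintro rfl; exact h2 _ _ hab hab
  · rintro rfl; exact h2 _ _ hab hbc
  · rintro rfl; exact h2 _ _ hbc hbc

section Counting

/-! ### Every vertex has at least two non-neighbours -/

open Classical in
/-- The set of out-neighbours of `v`. -/
noncomputable def outs {V : Type*} [Fintype V] (D : Digraph V) (v : V) : Finset V :=
  {w | D.Adj v w}

open Classical in
/-- The set of in-neighbours of `v`. -/
noncomputable def ins {V : Type*} [Fintype V] (D : Digraph V) (v : V) : Finset V :=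
  {w | D.Adj w v}

open Classical in
/-- The set of non-neighbours of `v`, without `v` itself. -/
noncomputable def nons {V : Type*} [Fintype V] (D : Digraph V) (v : V) : Finset V :=
  {w | NonAdj D v w}

variable {V : Type*} [Fintype V] {D : Digraph V}

@[simp] lemma mem_outs {v w : V} : w ∈ outs D v ↔ D.Adj v w := by simp [outs]
@[simp] lemma mem_ins {v w : V} : w ∈ ins D v ↔ D.Adj w v := by simp [ins]
@[simp] lemma mem_nons {v w : V} : w ∈ nons D v ↔ NonAdj D v w := by simp [nons]

lemma card_outs_add_card_ins_add_card_nons (hD : Admissible D) (hV : Fintype.card V = 8) (v : V) :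
    (outs D v).card + (ins D v).card + (nons D v).card = 7 := by
  classical
  have h2 := hD.asymm
  have hd : Disjoint (outs D v) (ins D v) := by
    rw [Finset.disjoint_left]; intro w; simp only [mem_outs, mem_ins]; exact h2 v w
  have hd' : Disjoint (outs D v ∪ ins D v) (nons D v) := by
    rw [Finset.disjoint_left]; intro w
    simp only [Finset.mem_union, mem_outs, mem_ins, mem_nons, NonAdj]; tauto
  have hu : outs D v ∪ ins D v ∪ nons D v = Finset.univ.erase v := by
    ext w
    simp only [Finset.mem_union, mem_outs, mem_ins, mem_nons, NonAdj, Finset.mem_erase,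
      Finset.mem_univ, and_true]
    constructor
    · rintro ((h | h) | h) rfl
      · exact h2 _ _ h h
      · exact h2 _ _ h h
      · exact h.1 rfl
    · tauto
  rw [← Finset.card_union_of_disjoint hd, ← Finset.card_union_of_disjoint hd', hu,
    Finset.card_erase_of_mem (Finset.mem_univ v), Finset.card_univ, hV]

lemma card_ins_pos (hD : Admissible D) (v : V) : 1 ≤ (ins D v).card := by
  obtain ⟨a, ha⟩ := hD.one_in v
  exact Finset.card_pos.2 ⟨a, by simpa using ha⟩

/-- Suppose that arcs leaving the out-neighbourhood `N` of `v` end in `N` or at `r`, and that `N` has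
at most five vertices. Then `r` sends no arc into `N`: if `r → y` with `y ∈ N`, the absence of
triangles keeps the two steps after `y` away from `r`, and five vertices do not suffice to give
`y` and its out-neighbours two out-neighbours each. -/
lemma not_adj_out_of_unique_nonAdj (hD : Admissible D) {v r : V} (ho : (outs D v).card ≤ 5)
    (hcl : ∀ o w, D.Adj v o → D.Adj o w → D.Adj v w ∨ w = r) (y : V) (hy : D.Adj v y) :
    ¬ D.Adj r y := by
  classical
  intro hry
  have h2 := hD.asymm
  have h3 := hD.no_triangle
  suffices H : ∀ a b, a ≠ b → D.Adj y a → D.Adj y b → ¬ D.Adj a b → False by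
    obtain ⟨a, b, hab, ha, hb⟩ := hD.two_out y
    by_cases h : D.Adj a b
    · exact H b a hab.symm hb ha (h2 _ _ h)
    · exact H a b hab ha hb h
  intro a b hab ha hb hnab
  have hva : D.Adj v a := (hcl y a hy ha).resolve_right (by rintro rfl; exact h2 _ _ hry ha)
  have hvb : D.Adj v b := (hcl y b hy hb).resolve_right (by rintro rfl; exact h2 _ _ hry hb)
  suffices H : ∀ p q, p ≠ q → D.Adj a p → D.Adj a q → ¬ D.Adj q p → False by
    obtain ⟨p, q, hpq, hp, hq⟩ := hD.two_out a
    by_cases h : D.Adj q p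
    · exact H q p hpq.symm hq hp (h2 _ _ h)
    · exact H p q hpq hp hq h
  intro p q hpq hp hq hnqp
  have hvp : D.Adj v p := (hcl a p hva hp).resolve_right (by rintro rfl; exact h3 _ _ _ hry ha hp)
  have hvq : D.Adj v q := (hcl a q hva hq).resolve_right (by rintro rfl; exact h3 _ _ _ hry ha hq)
  have hall : ∀ w, D.Adj v w → w = y ∨ w = a ∨ w = b ∨ w = p ∨ w = q := by
    have hsub : ({y, a, b, p, q} : Finset V) ⊆ outs D v := by
      intro w; simp only [Finset.mem_insert, Finset.mem_singleton, mem_outs]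
      rintro (rfl | rfl | rfl | rfl | rfl) <;> assumption
    have hc : ({y, a, b, p, q} : Finset V).card = 5 := by
      have e1 : y ≠ a := by rintro rfl; exact h2 _ _ ha ha
      have e2 : y ≠ b := by rintro rfl; exact h2 _ _ hb hb
      have e3 : y ≠ p := by rintro rfl; exact h2 _ _ ha hp
      have e4 : y ≠ q := by rintro rfl; exact h2 _ _ ha hq
      have e5 : a ≠ p := by rintro rfl; exact h2 _ _ hp hp
      have e6 : a ≠ q := by rintro rfl; exact h2 _ _ hq hq
      have e7 : b ≠ p := by rintro rfl; exact hnab hp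
      have e8 : b ≠ q := by rintro rfl; exact hnab hq
      simp [*]
    have := Finset.eq_of_subset_of_card_le hsub (by omega)
    intro w hw
    have : w ∈ ({y, a, b, p, q} : Finset V) := by rw [this]; simpa using hw
    simpa using this
  have hqb : D.Adj q b := by
    obtain ⟨w, hw, hqw⟩ := hD.exists_out_ne q r
    rcases hall w ((hcl q w hvq hqw).resolve_right hw) with rfl | rfl | rfl | rfl | rfl
    · exact absurd hqw (h3 _ _ _ ha hq)
    · exact absurd hqw (h2 _ _ hq)
    · exact hqw
    · exact absurd hqw hnqp
    · exact absurd hqw (h2 _ _ hqw)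
  have hbp : D.Adj b a ∧ D.Adj b p := by
    refine hD.adj_of_outs_subset_pair fun w hbw => ?_
    have hw : w ≠ r := by rintro rfl; exact h3 _ _ _ hry hb hbw
    rcases hall w ((hcl b w hvb hbw).resolve_right hw) with rfl | rfl | rfl | rfl | rfl
    · exact absurd hbw (h2 _ _ hb)
    · exact Or.inl rfl
    · exact absurd hbw (h2 _ _ hbw)
    · exact Or.inr rfl
    · exact absurd hbw (h2 _ _ hqb)
  exact h3 _ _ _ hq hqb hbp.1

lemma forall_outs_of_card_le_four {v a b c d : V} (hc : (outs D v).card ≤ 4)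
    (ha : D.Adj v a) (hb : D.Adj v b) (hc' : D.Adj v c) (hd : D.Adj v d) (hab : a ≠ b) (hac : a ≠ c)
    (had : a ≠ d) (hbc : b ≠ c) (hbd : b ≠ d) (hcd : c ≠ d) (w : V) (hw : D.Adj v w) :
    w = a ∨ w = b ∨ w = c ∨ w = d := by
  classical
  have hsub : ({a, b, c, d} : Finset V) ⊆ outs D v := by
    intro w; simp only [Finset.mem_insert, Finset.mem_singleton, mem_outs]
    rintro (rfl | rfl | rfl | rfl) <;> assumption
  have h4 : ({a, b, c, d} : Finset V).card = 4 := by simp [*]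
  have := Finset.eq_of_subset_of_card_le hsub (by omega)
  have hw' : w ∈ ({a, b, c, d} : Finset V) := by rw [this]; simpa using hw
  simpa using hw'

/-- Let `r` be the only non-neighbour of `v`; there is one because otherwise the out-neighbourhood
of `v` is closed under arcs. By `not_adj_out_of_unique_nonAdj`, all out-neighbours of `r` are
in-neighbours of `v`. This leaves room for only four out-neighbours of `v`. Of two out-neighbours of
`r`, one sends no arc to the other; its second out-neighbour `t` is then an out-neighbour of `v` with no
arc to `r`, so that `t` has two out-neighbours among the other three, and that produces a triangle. -/
lemma two_le_card_nons (hD : Admissible D) (hV : Fintype.card V = 8) (hs : Strong D) (v : V) :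
    2 ≤ (nons D v).card := by
  classical
  have h2 := hD.asymm
  have h3 := hD.no_triangle
  by_contra! hlt
  have h1 : (nons D v).card ≤ 1 := by omega
  have hcard := card_outs_add_card_ins_add_card_nons hD hV v
  have hI := card_ins_pos hD v
  obtain ⟨o, ho⟩ : ∃ o, D.Adj v o := let ⟨a, _, _, ha, _⟩ := hD.two_out v; ⟨a, ha⟩
  obtain ⟨r, hvr, hor, hro⟩ : ∃ r, NonAdj D v r ∧ ∃ o, D.Adj v o ∧ D.Adj o r := by
    by_contra! hcon
    have : ∀ w, Relation.ReflTransGen D.Adj o w → D.Adj v w := by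
      intro w hw
      induction hw with
      | refl => exact ho
      | @tail b c _ hbc ih =>
        by_contra hvc
        refine hcon c ⟨?_, hvc, h3 _ _ _ ih hbc⟩ b ih hbc
        rintro rfl; exact h2 _ _ ih hbc
    have := this v (hs o v)
    exact h2 _ _ this this
  have hr : ∀ w, NonAdj D v w → w = r := fun w hw =>
    Finset.card_le_one.1 h1 w (by simpa using hw) r (by simpa using hvr)
  have hR : 1 ≤ (nons D v).card := Finset.card_pos.2 ⟨r, by simpa using hvr⟩
  have hcl : ∀ o w, D.Adj v o → D.Adj o w → D.Adj v w ∨ w = r := by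
    intro o w ho how
    by_contra! hcon
    refine hcon.2 (hr w ⟨?_, hcon.1, h3 _ _ _ ho how⟩)
    rintro rfl; exact h2 _ _ ho how
  have hno := not_adj_out_of_unique_nonAdj hD (by omega) hcl
  have hrI : ∀ w, D.Adj r w → D.Adj w v := by
    intro w hrw
    by_contra hwv
    have hvw : ¬ D.Adj v w := fun h => hno w h hrw
    by_cases hw : w = v
    · subst hw; exact hvr.2.2 hrw
    · obtain rfl := hr w ⟨hw, hvw, hwv⟩
      exact h2 _ _ hrw hrw
  have hS : ∀ x, D.Adj v x → ∃ y, D.Adj v y ∧ D.Adj x y := by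
    intro x hx
    obtain ⟨y, hy, hxy⟩ := hD.exists_out_ne x r
    exact ⟨y, (hcl x y hx hxy).resolve_right hy, hxy⟩
  -- Two out-neighbours of `r`, labelled so that there is no arc `i → j`.
  obtain ⟨i, j, hij, hi, hj, hnij⟩ : ∃ i j, i ≠ j ∧ D.Adj r i ∧ D.Adj r j ∧ ¬ D.Adj i j := by
    obtain ⟨i, j, hij, hi, hj⟩ := hD.two_out r
    by_cases h : D.Adj i j
    · exact ⟨j, i, hij.symm, hj, hi, h2 _ _ h⟩
    · exact ⟨i, j, hij, hi, hj, h⟩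
  have hO4 : ∀ o, D.Adj v o → 4 ≤ (outs D v).card := by
    intro o ho
    obtain ⟨a, b, c, ha, hb, hc, -, -, -, h⟩ := exists_path_of_no_sink hD (S := D.Adj v) ho hS
    have hsub : ({o, a, b, c} : Finset V) ⊆ outs D v := by
      intro w; simp only [Finset.mem_insert, Finset.mem_singleton, mem_outs]
      rintro (rfl | rfl | rfl | rfl) <;> assumption
    have := Finset.card_le_card hsub
    have h4 : ({o, a, b, c} : Finset V).card = 4 := by simp [h]
    omega
  have hI2 : ∀ w, D.Adj w v → w = i ∨ w = j := by
    have hsub : ({i, j} : Finset V) ⊆ ins D v := by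
      intro w; simp only [Finset.mem_insert, Finset.mem_singleton, mem_ins]
      rintro (rfl | rfl)
      exacts [hrI _ hi, hrI _ hj]
    have h4 := hO4 o ho
    have := Finset.eq_of_subset_of_card_le hsub (by rw [Finset.card_pair hij]; omega)
    intro w hw
    have : w ∈ ({i, j} : Finset V) := by rw [this]; simpa using hw
    simpa using this
  have hOle : (outs D v).card ≤ 4 := by
    have : ({i, j} : Finset V).card ≤ (ins D v).card := Finset.card_le_card (by
      intro w; simp only [Finset.mem_insert, Finset.mem_singleton, mem_ins]
      rintro (rfl | rfl)
      exacts [hrI _ hi, hrI _ hj])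
    rw [Finset.card_pair hij] at this
    omega
  -- The second out-neighbour of `i` can only be an out-neighbour of `v`.
  obtain ⟨t, ht, hit⟩ := hD.exists_out_ne i v
  have hvt : D.Adj v t := by
    by_contra hvt
    by_cases htv : D.Adj t v
    · rcases hI2 t htv with rfl | rfl
      · exact h2 _ _ hit hit
      · exact hnij hit
    · obtain rfl := hr t ⟨ht, hvt, htv⟩
      exact h2 _ _ hit hi
  have htr : ¬ D.Adj t r := h3 _ _ _ hi hit
  have htcl : ∀ w, D.Adj t w → D.Adj v w := fun w hw =>
    (hcl t w hvt hw).resolve_right (by rintro rfl; exact htr hw)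
  obtain ⟨a, b, hab, ha, hb, hnab⟩ : ∃ a b, a ≠ b ∧ D.Adj t a ∧ D.Adj t b ∧ ¬ D.Adj a b := by
    obtain ⟨a, b, hab, ha, hb⟩ := hD.two_out t
    by_cases h : D.Adj a b
    · exact ⟨b, a, hab.symm, hb, ha, h2 _ _ h⟩
    · exact ⟨a, b, hab, ha, hb, h⟩
  obtain ⟨c, hvc, hac⟩ := hS a (htcl a ha)
  have hall := forall_outs_of_card_le_four hOle hvt (htcl a ha) (htcl b hb) hvc
    (by rintro rfl; exact h2 _ _ ha ha) (by rintro rfl; exact h2 _ _ hb hb)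
    (by rintro rfl; exact h2 _ _ ha hac) hab (by rintro rfl; exact h2 _ _ hac hac)
    (by rintro rfl; exact hnab hac)
  have hcb : D.Adj c b := by
    obtain ⟨w, hvw, hcw⟩ := hS c hvc
    rcases hall w hvw with rfl | rfl | rfl | rfl
    · exact absurd hcw (h3 _ _ _ ha hac)
    · exact absurd hcw (h2 _ _ hac)
    · exact hcw
    · exact absurd hcw (h2 _ _ hcw)
  obtain ⟨w, hvw, hbw⟩ := hS b (htcl b hb)
  rcases hall w hvw with rfl | rfl | rfl | rfl
  · exact h2 _ _ hb hbw
  · exact h3 _ _ _ hac hcb hbw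
  · exact h2 _ _ hbw hbw
  · exact h2 _ _ hcb hbw

end Counting

variable {V : Type*} {D : Digraph V}

lemma NonAdj.symm {v w : V} (h : NonAdj D v w) : NonAdj D w v := ⟨h.1.symm, h.2.2, h.2.1⟩

/-! ### The successor of a vertex whose out-neighbours are its non-neighbours -/

/-- Every vertex has exactly two non-neighbours: the complement of the underlying graph is
`2`-regular. -/
def CoRegular (D : Digraph V) : Prop :=
  ∀ v, ∃ a b, a ≠ b ∧ ∀ w, NonAdj D v w ↔ w = a ∨ w = b

lemma CoRegular.eq_or_eq (hN : CoRegular D) {v a b c : V} (ha : NonAdj D v a) (hb : NonAdj D v b)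
    (hab : a ≠ b) (hc : NonAdj D v c) : c = a ∨ c = b := by
  obtain ⟨x, y, hxy, h⟩ := hN v
  rw [h] at ha hb hc
  grind

lemma CoRegular.iff_eq_or_eq (hN : CoRegular D) {v a b : V} (ha : NonAdj D v a)
    (hb : NonAdj D v b) (hab : a ≠ b) (c : V) : NonAdj D v c ↔ c = a ∨ c = b :=
  ⟨hN.eq_or_eq ha hb hab, by rintro (rfl | rfl) <;> assumption⟩

/-- The out-neighbours of `v` are a directed `4`-cycle `c₀ c₁ c₂ c₃`, its only in-neighbour is `i`
and its non-neighbours are `r` and `s`; these eight are all the vertices. -/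
structure CyclicOuts (D : Digraph V) (v c₀ c₁ c₂ c₃ i r s : V) : Prop where
  v₀ : D.Adj v c₀
  v₁ : D.Adj v c₁
  v₂ : D.Adj v c₂
  v₃ : D.Adj v c₃
  a₀ : D.Adj c₀ c₁
  a₁ : D.Adj c₁ c₂
  a₂ : D.Adj c₂ c₃
  a₃ : D.Adj c₃ c₀
  iv : D.Adj i v
  vr : NonAdj D v r
  vs : NonAdj D v s
  cover : ∀ x, x = v ∨ x = c₀ ∨ x = c₁ ∨ x = c₂ ∨ x = c₃ ∨ x = i ∨ x = r ∨ x = s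

namespace CyclicOuts

variable {v c₀ c₁ c₂ c₃ i r s : V}

lemma rotate (h : CyclicOuts D v c₀ c₁ c₂ c₃ i r s) : CyclicOuts D v c₁ c₂ c₃ c₀ i r s where
  v₀ := h.v₁
  v₁ := h.v₂
  v₂ := h.v₃
  v₃ := h.v₀
  a₀ := h.a₁
  a₁ := h.a₂
  a₂ := h.a₃
  a₃ := h.a₀
  iv := h.iv
  vr := h.vr
  vs := h.vs
  cover x := by have := h.cover x; tauto

lemma nonAdj_opposite (h : CyclicOuts D v c₀ c₁ c₂ c₃ i r s) (hD : Admissible D) :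
    NonAdj D c₀ c₂ := by
  refine ⟨?_, fun h' => hD.no_triangle _ _ _ h' h.a₂ h.a₃,
    fun h' => hD.no_triangle _ _ _ h.a₀ h.a₁ h'⟩
  rintro e
  exact hD.asymm _ _ h.a₀ (e ▸ h.a₁)

lemma not_adj_in (h : CyclicOuts D v c₀ c₁ c₂ c₃ i r s) (hD : Admissible D) :
    ¬ D.Adj c₀ i := fun h' => hD.no_triangle _ _ _ h.v₀ h' h.iv

lemma adj_or_adj (h : CyclicOuts D v c₀ c₁ c₂ c₃ i r s) (hD : Admissible D) :
    D.Adj c₀ r ∨ D.Adj c₀ s := by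
  have hirr : ∀ x, ¬ D.Adj x x := fun x hx => hD.asymm _ _ hx hx
  obtain ⟨w, hw, hcw⟩ := hD.exists_out_ne c₀ c₁
  rcases h.cover w with rfl | rfl | rfl | rfl | rfl | rfl | rfl | rfl
  · exact absurd hcw (hD.asymm _ _ h.v₀)
  · exact absurd hcw (hirr _)
  · exact absurd rfl hw
  · exact absurd hcw (h.nonAdj_opposite hD).2.1
  · exact absurd hcw (hD.asymm _ _ h.a₃)
  · exact absurd hcw (h.not_adj_in hD)
  · exact Or.inl hcw
  · exact Or.inr hcw

lemma adj_or_nonAdj_in (h : CyclicOuts D v c₀ c₁ c₂ c₃ i r s) (hD : Admissible D) :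
    D.Adj i c₀ ∨ NonAdj D i c₀ := by
  by_cases h' : D.Adj i c₀
  · exact Or.inl h'
  · refine Or.inr ⟨?_, h', h.not_adj_in hD⟩
    rintro rfl
    exact hD.asymm _ _ h.v₀ h.iv

/-- With `r → i`, the cycle has no `c₀` non-adjacent to `r` followed by `c₁ → r`. Both `c₀` and `c₁`
then have their two non-neighbours accounted for, so that `c₀ → s`, `c₁ → s`; a further
out-neighbour `x` of `i` on the cycle gives `x → s` and `r → x`, hence `r → s`. This leaves at most
one vertex to which `s` can send an arc. -/
lemma false_of_nonAdj_of_adj (h : CyclicOuts D v c₀ c₁ c₂ c₃ i r s) (hD : Admissible D)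
    (hN : CoRegular D) (hri : D.Adj r i) (h₀ : NonAdj D r c₀) (h₁ : D.Adj c₁ r) : False := by
  have h2 := hD.asymm
  have h3 := hD.no_triangle
  have hirr : ∀ x, ¬ D.Adj x x := fun x hx => h2 _ _ hx hx
  have hrot := h.rotate
  have hne : v ≠ c₀ := by rintro rfl; exact hirr _ h.v₀
  have hi₁ : NonAdj D i c₁ := (hrot.adj_or_nonAdj_in hD).resolve_left (h3 _ _ _ h₁ hri)
  have hi₀ : D.Adj i c₀ := by
    refine (h.adj_or_nonAdj_in hD).resolve_right fun h' => ?_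
    rcases hN.eq_or_eq (h.nonAdj_opposite hD) h₀.symm
      (by rintro rfl; exact h.vr.2.1 h.v₂) h'.symm with rfl | rfl
    · exact h2 _ _ h.v₂ h.iv
    · exact hirr _ hri
  have hs₀ : D.Adj c₀ s := (h.adj_or_adj hD).resolve_left h₀.2.2
  obtain ⟨x, hx, hix, hxs⟩ : ∃ x, (x = c₂ ∨ x = c₃) ∧ D.Adj i x ∧ (D.Adj x r ∨ D.Adj x s) := by
    rcases hrot.rotate.adj_or_nonAdj_in hD with h' | h'
    · exact ⟨c₂, Or.inl rfl, h', hrot.rotate.adj_or_adj hD⟩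
    · refine ⟨c₃, Or.inr rfl, (hrot.rotate.rotate.adj_or_nonAdj_in hD).resolve_right fun h'' => ?_,
        hrot.rotate.rotate.adj_or_adj hD⟩
      rcases hN.eq_or_eq hi₁ h' (by rintro rfl; exact hirr _ h.a₁) h'' with e | e
      · exact (hrot.nonAdj_opposite hD).1 e
      · exact hirr _ (e ▸ h.a₂)
  have hxr : ¬ D.Adj x r := fun h' => h3 _ _ _ h' hri hix
  replace hxs := hxs.resolve_left hxr
  have hvx : D.Adj v x := by rcases hx with rfl | rfl; exacts [h.v₂, h.v₃]
  have hrx : D.Adj r x := by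
    by_contra hrx
    have hxr' : NonAdj D r x := ⟨by rintro rfl; exact h2 _ _ hri hix, hrx, hxr⟩
    rcases hN.eq_or_eq h.vr.symm h₀ hne hxr' with rfl | rfl
    · exact hirr _ hvx
    · rcases hx with e | e
      · exact (h.nonAdj_opposite hD).1 e.symm
      · exact hirr x (e.symm ▸ h.a₃)
  have hrs : D.Adj r s := by
    by_contra hrs
    have hrs' : NonAdj D r s := ⟨by rintro rfl; exact hxr hxs, hrs, fun h' => h3 _ _ _ hxs h' hrx⟩
    rcases hN.eq_or_eq h.vr.symm h₀ hne hrs' with e | e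
    · exact h.vs.1 e
    · exact hirr c₀ (e ▸ hs₀)
  have hs₁ : D.Adj c₁ s := by
    by_contra hs₁
    have hs₁' : NonAdj D c₁ s :=
      ⟨by rintro rfl; exact h2 _ _ hrs h₁, hs₁, fun h' => h3 _ _ _ h₁ hrs h'⟩
    rcases hN.eq_or_eq (hrot.nonAdj_opposite hD) hi₁.symm
      (by rintro rfl; exact h2 _ _ h.v₃ h.iv) hs₁' with rfl | rfl
    · exact h.vs.2.1 h.v₃
    · exact h.vs.2.2 h.iv
  obtain ⟨y, hy⟩ : ∃ y, ∀ w, D.Adj s w → w = y := by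
    have key : ∀ w, D.Adj s w → w = c₂ ∨ w = c₃ := by
      intro w hw
      rcases h.cover w with rfl | rfl | rfl | rfl | rfl | rfl | rfl | rfl
      · exact absurd hw h.vs.2.2
      · exact absurd hw (h2 _ _ hs₀)
      · exact absurd hw (h2 _ _ hs₁)
      · exact Or.inl rfl
      · exact Or.inr rfl
      · exact absurd hw (h3 _ _ _ hi₀ hs₀)
      · exact absurd hw (h2 _ _ hrs)
      · exact absurd hw (hirr _)
    rcases hx with rfl | rfl
    · exact ⟨c₃, fun w hw => (key w hw).resolve_left (by rintro rfl; exact h2 _ _ hxs hw)⟩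
    · exact ⟨c₂, fun w hw => (key w hw).resolve_right (by rintro rfl; exact h2 _ _ hxs hw)⟩
  obtain ⟨w, hw, hsw⟩ := hD.exists_out_ne s y
  exact hw (hy w hsw)

/-- By `false_of_nonAdj_of_adj`, `c₁ → r` implies `c₀ → r`, and so all around the cycle. As `i` has
only two non-neighbours, some `x` on the cycle satisfies `i → x` and `r → x`; hence no vertex of the
cycle sends an arc to `r`, and neither does `s`, because `x → s`. So `r` has no in-neighbour. -/
lemma false_of_adj (h : CyclicOuts D v c₀ c₁ c₂ c₃ i r s) (hD : Admissible D)
    (hN : CoRegular D) (hri : D.Adj r i) : False := by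
  have h2 := hD.asymm
  have h3 := hD.no_triangle
  have hirr : ∀ x, ¬ D.Adj x x := fun x hx => h2 _ _ hx hx
  have hr₁ := h.rotate
  have hr₂ := hr₁.rotate
  have hr₃ := hr₂.rotate
  obtain ⟨x, hx, hix, hrx⟩ :
      ∃ x, (x = c₀ ∨ x = c₁ ∨ x = c₂ ∨ x = c₃) ∧ D.Adj i x ∧ D.Adj r x := by
    obtain ⟨x, y, hxy, hx, hy, hix, hiy⟩ : ∃ x y, x ≠ y ∧ (x = c₀ ∨ x = c₁ ∨ x = c₂ ∨ x = c₃) ∧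
        (y = c₀ ∨ y = c₁ ∨ y = c₂ ∨ y = c₃) ∧ D.Adj i x ∧ D.Adj i y := by
      have e₀ := h.adj_or_nonAdj_in hD
      have e₁ := hr₁.adj_or_nonAdj_in hD
      have e₂ := hr₂.adj_or_nonAdj_in hD
      have e₃ := hr₃.adj_or_nonAdj_in hD
      have d₀₁ : c₀ ≠ c₁ := by rintro rfl; exact hirr _ h.a₀
      have d₁₂ : c₁ ≠ c₂ := by rintro rfl; exact hirr _ h.a₁
      have d₂₃ : c₂ ≠ c₃ := by rintro rfl; exact hirr _ h.a₂
      have d₃₀ : c₃ ≠ c₀ := by rintro rfl; exact hirr _ h.a₃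
      have d₀₂ := (h.nonAdj_opposite hD).1
      have d₁₃ := (hr₁.nonAdj_opposite hD).1
      obtain ⟨p, q, hpq, hi⟩ := hN i
      simp only [hi] at e₀ e₁ e₂ e₃
      grind
    have hv : ∀ z, (z = c₀ ∨ z = c₁ ∨ z = c₂ ∨ z = c₃) → D.Adj v z := by
      rintro z (rfl | rfl | rfl | rfl)
      exacts [h.v₀, h.v₁, h.v₂, h.v₃]
    have key : ∀ z, D.Adj i z → ¬ NonAdj D r z → D.Adj r z := by
      intro z hiz hz
      by_contra hrz
      exact hz ⟨by rintro rfl; exact h2 _ _ hri hiz, hrz, fun h' => h3 _ _ _ h' hri hiz⟩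
    by_cases hrx : NonAdj D r x
    · refine ⟨y, hy, hiy, key y hiy fun hry => ?_⟩
      have hne : v ≠ x := fun e => hirr x (by simpa only [e] using hv x hx)
      rcases hN.eq_or_eq h.vr.symm hrx hne hry with e | e
      · exact hirr _ (e ▸ hv y hy)
      · exact hxy e.symm
    · exact ⟨x, hx, hix, key x hix hrx⟩
  have hxr : ¬ D.Adj x r := h2 _ _ hrx
  have hxs : D.Adj x s := by
    rcases hx with rfl | rfl | rfl | rfl
    · exact (h.adj_or_adj hD).resolve_left hxr
    · exact (hr₁.adj_or_adj hD).resolve_left hxr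
    · exact (hr₂.adj_or_adj hD).resolve_left hxr
    · exact (hr₃.adj_or_adj hD).resolve_left hxr
  have back : ∀ {a₀ a₁ a₂ a₃}, CyclicOuts D v a₀ a₁ a₂ a₃ i r s → D.Adj a₁ r → D.Adj a₀ r := by
    intro a₀ a₁ a₂ a₃ ha har
    by_contra hc
    exact ha.false_of_nonAdj_of_adj hD hN hri
      ⟨by rintro rfl; exact h.vr.2.1 ha.v₀, fun h' => h3 _ _ _ h' ha.a₀ har, hc⟩ har
  have b₀ := back h
  have b₁ := back hr₁
  have b₂ := back hr₂
  have b₃ := back hr₃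
  have hc : ¬ D.Adj c₀ r ∧ ¬ D.Adj c₁ r ∧ ¬ D.Adj c₂ r ∧ ¬ D.Adj c₃ r := by
    rcases hx with rfl | rfl | rfl | rfl <;> tauto
  obtain ⟨w, hw⟩ := hD.one_in r
  rcases h.cover w with rfl | rfl | rfl | rfl | rfl | rfl | rfl | rfl
  · exact h.vr.2.1 hw
  · exact hc.1 hw
  · exact hc.2.1 hw
  · exact hc.2.2.1 hw
  · exact hc.2.2.2 hw
  · exact h2 _ _ hri hw
  · exact hirr _ hw
  · exact h3 _ _ _ hxs hw hrx

lemma swap (h : CyclicOuts D v c₀ c₁ c₂ c₃ i r s) : CyclicOuts D v c₀ c₁ c₂ c₃ i s r :=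
  { h with vr := h.vs, vs := h.vr, cover := fun x => by have := h.cover x; tauto }

lemma not_cyclicOuts (hD : Admissible D) (hN : CoRegular D) :
    ¬ CyclicOuts D v c₀ c₁ c₂ c₃ i r s := by
  intro h
  obtain ⟨w, hw⟩ := hD.one_in i
  rcases h.cover w with rfl | rfl | rfl | rfl | rfl | rfl | rfl | rfl
  · exact hD.asymm _ _ h.iv hw
  · exact h.not_adj_in hD hw
  · exact h.rotate.not_adj_in hD hw
  · exact h.rotate.rotate.not_adj_in hD hw
  · exact h.rotate.rotate.rotate.not_adj_in hD hw
  · exact hD.asymm _ _ hw hw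
  · exact h.false_of_adj hD hN hw
  · exact h.swap.false_of_adj hD hN hw

end CyclicOuts

/-- Arcs leaving the out-neighbourhood of `v` end at non-neighbours of `v`. So an out-neighbour `o`
of `v` that sends no arc to another out-neighbour of `v` has exactly the two non-neighbours of `v` as
out-neighbours. If there were no such `o`, the out-neighbourhood would contain a cycle, of length at
least `4`; it would be that cycle, which `CyclicOuts.not_cyclicOuts` excludes. -/
lemma exists_adj_forall_adj_iff_nonAdj [Fintype V] (hD : Admissible D) (hV : Fintype.card V = 8)
    (hN : CoRegular D) (v : V) : ∃ o, D.Adj v o ∧ ∀ w, D.Adj o w ↔ NonAdj D v w := by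
  classical
  have h2 := hD.asymm
  have h3 := hD.no_triangle
  obtain ⟨r, s, hrs, hv⟩ := hN v
  have hcard := card_outs_add_card_ins_add_card_nons hD hV v
  have hI := card_ins_pos hD v
  have hR : (nons D v).card = 2 := by
    rw [← Finset.card_pair hrs]; congr 1; ext w; simp [hv]
  have hcase : ∀ x w, D.Adj v x → D.Adj x w → ¬ D.Adj v w → NonAdj D v w := by
    intro x w hx hw hvw
    refine ⟨?_, hvw, h3 _ _ _ hx hw⟩
    rintro rfl; exact h2 _ _ hx hw
  by_cases hsink : ∃ o, D.Adj v o ∧ ∀ w, D.Adj o w → ¬ D.Adj v w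
  · obtain ⟨o, ho, hw⟩ := hsink
    have hsub : ∀ w, D.Adj o w → NonAdj D v w := fun w how => hcase o w ho how (hw w how)
    have hrs := hD.adj_of_outs_subset_pair fun w how => (hv w).1 (hsub w how)
    refine ⟨o, ho, fun w => ⟨hsub w, fun h => ?_⟩⟩
    rcases (hv w).1 h with rfl | rfl
    exacts [hrs.1, hrs.2]
  exfalso
  push Not at hsink
  obtain ⟨o, ho⟩ : ∃ o, D.Adj v o := let ⟨a, _, _, ha, _⟩ := hD.two_out v; ⟨a, ha⟩
  obtain ⟨a, b, c, ha, hb, hc, hoa, hab, hbc, n1, n2, n3, n4, n5, n6⟩ :=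
    exists_path_of_no_sink hD (S := D.Adj v) ho fun x hx => by
      obtain ⟨w, h1, h2⟩ := hsink x hx; exact ⟨w, h2, h1⟩
  have hall := forall_outs_of_card_le_four (by omega) ho ha hb hc n1 n2 n3 n4 n5 n6
  have h4 : 4 ≤ (outs D v).card := by
    have hsub : ({o, a, b, c} : Finset V) ⊆ outs D v := by
      intro w; simp only [Finset.mem_insert, Finset.mem_singleton, mem_outs]
      rintro (rfl | rfl | rfl | rfl) <;> assumption
    have h4 : ({o, a, b, c} : Finset V).card = 4 := by simp [*]
    exact h4 ▸ Finset.card_le_card hsub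
  obtain ⟨i, hi⟩ := hD.one_in v
  have hall' : ∀ w, D.Adj w v → w = i := fun w hw =>
    Finset.card_le_one.1 (show (ins D v).card ≤ 1 by omega) w (by simpa using hw) i
      (by simpa using hi)
  have hco : D.Adj c o := by
    obtain ⟨w, hcw, hvw⟩ := hsink c hc
    rcases hall w hvw with rfl | rfl | rfl | rfl
    · exact hcw
    · exact absurd hcw (h3 _ _ _ hab hbc)
    · exact absurd hcw (h2 _ _ hbc)
    · exact absurd hcw (h2 _ _ hcw)
  refine CyclicOuts.not_cyclicOuts hD hN (v := v) (c₀ := o) (c₁ := a) (c₂ := b) (c₃ := c) (i := i)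
    (r := r) (s := s) ⟨ho, ha, hb, hc, hoa, hab, hbc, hco, hi, (hv r).2 (Or.inl rfl),
      (hv s).2 (Or.inr rfl), fun x => ?_⟩
  by_cases hxv : x = v
  · exact Or.inl hxv
  by_cases h1 : D.Adj v x
  · have := hall x h1; tauto
  by_cases h1' : D.Adj x v
  · have := hall' x h1'; tauto
  have := (hv x).1 ⟨hxv, h1, h1'⟩
  tauto


/-! ### A directed four-cycle of successors -/

/-- Along a walk `w` in which the out-neighbours of `w (n + 1)` are the non-neighbours of `w n`, and
in which `w (n + 4) ≠ w n` throughout, the arcs are those of the circulant digraph on `ℤ/7` with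
steps `1` and `4`. -/
lemma iterate_seven_eq_of_no_four_cycle (hD : Admissible D) (hN : CoRegular D) {w : ℕ → V}
    (hw : ∀ n, D.Adj (w n) (w (n + 1))) (hadj : ∀ n x, D.Adj (w (n + 1)) x ↔ NonAdj D (w n) x)
    (h4 : ∀ n, w (n + 4) ≠ w n) (n : ℕ) :
    (∀ x, D.Adj (w (n + 3)) x ↔ x = w n ∨ x = w (n + 4)) ∧ w (n + 7) = w n := by
  have h2 := hD.asymm
  -- The non-neighbours of `w (n + 2)` are `w n` and `w (n + 4)`.
  have n2 : ∀ n, NonAdj D (w n) (w (n + 2)) := fun n => (hadj n _).1 (hw (n + 1))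
  have b3 : ∀ n, D.Adj (w (n + 3)) (w n) := fun n => (hadj (n + 2) _).2 (n2 n).symm
  have hout : ∀ n x, D.Adj (w (n + 3)) x ↔ x = w n ∨ x = w (n + 4) := fun n x => by
    rw [hadj (n + 2), hN.iff_eq_or_eq (n2 n).symm (n2 (n + 2)) (h4 n).symm]
  have f4 : ∀ n, D.Adj (w (n + 3)) (w (n + 7)) := by
    intro n
    by_contra hc
    refine h2 _ _ (b3 (n + 4)) ((hadj (n + 3) _).2 ⟨h4 (n + 3), hc, fun h' => ?_⟩)
    exact ((hadj (n + 6) _).1 h').2.1 (b3 (n + 3))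
  refine ⟨hout n, ((hout n _).1 (f4 n)).resolve_right fun e => ?_⟩
  have := b3 (n + 4)
  rw [e] at this
  exact h2 _ _ this this

/-- Otherwise the orbit of any vertex under `σ` has at most seven vertices and is closed under
arcs, which a strong digraph on eight vertices does not allow. -/
lemma exists_iterate_four_eq [Fintype V] (hD : Admissible D) (hV : Fintype.card V = 8)
    (hs : Strong D) (hN : CoRegular D) {σ : V → V} (hσ : ∀ v, D.Adj v (σ v))
    (hadj : ∀ v w, D.Adj (σ v) w ↔ NonAdj D v w) : ∃ v, σ (σ (σ (σ v))) = v := by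
  classical
  by_contra! hc
  obtain ⟨v₀⟩ : Nonempty V := Fintype.card_pos_iff.1 (by omega)
  set w : ℕ → V := fun n => σ^[n] v₀ with hwdef
  have hsucc : ∀ n, w (n + 1) = σ (w n) := fun n => Function.iterate_succ_apply' σ n v₀
  have key := iterate_seven_eq_of_no_four_cycle hD hN (w := w)
    (fun n => by rw [hsucc]; exact hσ _) (fun n x => by rw [hsucc]; exact hadj _ _)
    (fun n => by rw [hsucc, hsucc, hsucc, hsucc]; exact hc _)
  have hmod : ∀ n, w n = w (n % 7) := by
    intro n
    induction n using Nat.strong_induction_on with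
    | _ n ih =>
      by_cases h : n < 7
      · rw [Nat.mod_eq_of_lt h]
      · obtain ⟨m, rfl⟩ : ∃ m, n = m + 7 := ⟨n - 7, by omega⟩
        rw [(key m).2, ih m (by omega), Nat.add_mod_right]
  have hreach : ∀ x, Relation.ReflTransGen D.Adj (w 0) x → ∃ n, x = w n := by
    intro x hx
    induction hx with
    | refl => exact ⟨0, rfl⟩
    | @tail b c _ hbc ih =>
      obtain ⟨n, rfl⟩ := ih
      rw [← (key n).2, (key (n + 4)).1] at hbc
      rcases hbc with rfl | rfl
      exacts [⟨_, rfl⟩, ⟨_, rfl⟩]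
  have hsub : (Finset.univ : Finset V) ⊆ (Finset.range 7).image w := by
    intro x _
    obtain ⟨n, rfl⟩ := hreach x (hs _ _)
    exact Finset.mem_image.2 ⟨n % 7, by simp [Nat.mod_lt], (hmod n).symm⟩
  have := (Finset.card_le_card hsub).trans Finset.card_image_le
  rw [Finset.card_univ, hV, Finset.card_range] at this
  omega

/-! ### Reconstruction of the blow-up -/

/-- A directed `4`-cycle `v → u → r → x → v` in which the out-neighbours of each vertex are its
successor and one more vertex, the twin of the successor, and the non-neighbours of each vertex
are the opposite vertex and the twin of the opposite vertex. -/
structure TwinCycle (D : Digraph V) (v v' u u' r r' x x' : V) : Prop where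
  ne_v : v ≠ v'
  ne_u : u ≠ u'
  ne_r : r ≠ r'
  ne_x : x ≠ x'
  outs_v : ∀ w, D.Adj v w ↔ w = u ∨ w = u'
  outs_u : ∀ w, D.Adj u w ↔ w = r ∨ w = r'
  outs_r : ∀ w, D.Adj r w ↔ w = x ∨ w = x'
  outs_x : ∀ w, D.Adj x w ↔ w = v ∨ w = v'
  nons_v : ∀ w, NonAdj D v w ↔ w = r ∨ w = r'
  nons_u : ∀ w, NonAdj D u w ↔ w = x ∨ w = x'
  nons_r : ∀ w, NonAdj D r w ↔ w = v ∨ w = v'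
  nons_x : ∀ w, NonAdj D x w ↔ w = u ∨ w = u'

namespace TwinCycle

variable {v v' u u' r r' x x' : V}

lemma rotate (h : TwinCycle D v v' u u' r r' x x') : TwinCycle D u u' r r' x x' v v' :=
  ⟨h.ne_u, h.ne_r, h.ne_x, h.ne_v, h.outs_u, h.outs_r, h.outs_x, h.outs_v,
    h.nons_u, h.nons_r, h.nons_x, h.nons_v⟩

/-- A common value `c` of `u'` and `x'` would be an out-neighbour of both `v` and `r` and a
non-neighbour of both `u` and `x`; every out-neighbour of `c` would then be a second non-neighbour
of `v`, leaving `c` only one. -/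
lemma twin_ne_twin (h : TwinCycle D v v' u u' r r' x x') (hD : Admissible D) : u' ≠ x' := by
  rintro rfl
  have h2 := hD.asymm
  have h3 := hD.no_triangle
  have hvc := (h.outs_v u').2 (Or.inr rfl)
  have hrc := (h.outs_r u').2 (Or.inr rfl)
  have hcu := ((h.nons_u u').2 (Or.inr rfl)).symm
  have hcx := ((h.nons_x u').2 (Or.inr rfl)).symm
  have hux : u ≠ x := fun e => ((h.nons_u x).2 (Or.inl rfl)).1 e.symm
  obtain ⟨y, hy, hcy⟩ := hD.exists_out_ne u' r'
  have hyu : y ≠ u := by rintro rfl; exact hcu.2.1 hcy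
  have hyx : y ≠ x := by rintro rfl; exact hcx.2.1 hcy
  have hyc : y ≠ u' := by rintro rfl; exact h2 _ _ hcy hcy
  have hvy : NonAdj D v y := by
    refine ⟨by rintro rfl; exact h2 _ _ hvc hcy, fun h' => ?_, h3 _ _ _ hvc hcy⟩
    rcases (h.outs_v y).1 h' with e | e
    exacts [hyu e, hyc e]
  rcases (h.nons_v y).1 hvy with rfl | e
  · exact h2 _ _ hrc hcy
  · exact hy e

lemma twin_ne_opposite_twin (h : TwinCycle D v v' u u' r r' x x') (hD : Admissible D) :
    v' ≠ r' :=
  h.rotate.rotate.rotate.twin_ne_twin hD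

lemma twin_ne_next_twin (h : TwinCycle D v v' u u' r r' x x') : v' ≠ u' := by
  rintro rfl
  exact ((h.nons_x v').2 (Or.inr rfl)).2.1 ((h.outs_x v').2 (Or.inr rfl))

lemma twin_ne_opposite (h : TwinCycle D v v' u u' r r' x x') : v' ≠ r :=
  ((h.nons_r v').2 (Or.inr rfl)).1

lemma twin_adj_next (h : TwinCycle D v v' u u' r r' x x') (hD : Admissible D) :
    D.Adj v' u := by
  have hxv := (h.outs_x v').2 (Or.inr rfl)
  have hrv := (h.nons_r v').2 (Or.inr rfl)
  by_contra hc
  have huv : ¬ D.Adj u v' := by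
    rw [h.outs_u]
    rintro (e | e)
    exacts [h.twin_ne_opposite e, h.twin_ne_opposite_twin hD e]
  have hne : v' ≠ u := by
    rintro rfl
    exact ((h.nons_x v').2 (Or.inl rfl)).2.1 hxv
  rcases (h.nons_u v').1 ⟨hne, huv, hc⟩ with rfl | rfl
  · exact hD.asymm _ _ hxv hxv
  · exact hrv.2.1 ((h.outs_r v').2 (Or.inr rfl))

lemma twin_adj_self (h : TwinCycle D v v' u u' r r' x x') (hD : Admissible D) :
    D.Adj v' v := by
  have hxv := (h.outs_x v').2 (Or.inr rfl)
  by_contra hc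
  have hvv : ¬ D.Adj v v' := by
    rw [h.outs_v, ← h.nons_x]
    exact fun h' => h'.2.1 hxv
  rcases (h.nons_v v').1 ⟨h.ne_v.symm, hvv, hc⟩ with e | e
  exacts [h.twin_ne_opposite e, h.twin_ne_opposite_twin hD e]

lemma nonAdj_twin_twin (h : TwinCycle D v v' u u' r r' x x') (hD : Admissible D) :
    NonAdj D v' r' :=
  ⟨(h.twin_ne_opposite_twin hD).symm,
    fun h' => hD.no_triangle _ _ _ ((h.outs_x v').2 (Or.inr rfl)) h'
      (h.rotate.rotate.twin_adj_next hD),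
    fun h' => hD.no_triangle _ _ _ (h.twin_adj_next hD) ((h.outs_u r').2 (Or.inr rfl)) h'⟩

lemma twin_adj_twin (h : TwinCycle D v v' u u' r r' x x') (hD : Admissible D)
    (hN : CoRegular D) : D.Adj v' u' := by
  have hvu := (h.outs_v u').2 (Or.inr rfl)
  by_contra hc
  have huv : ¬ D.Adj u' v' := fun h' =>
    hD.no_triangle _ _ _ hvu h' (h.twin_adj_self hD)
  rcases hN.eq_or_eq ((h.nons_r v').2 (Or.inr rfl)).symm (h.nonAdj_twin_twin hD) h.ne_r
    ⟨h.twin_ne_next_twin.symm, hc, huv⟩ with rfl | rfl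
  · exact ((h.nons_v u').2 (Or.inl rfl)).2.1 hvu
  · exact ((h.nons_v u').2 (Or.inr rfl)).2.1 hvu

end TwinCycle

lemma exists_twinCycle [Fintype V] (hD : Admissible D) (hV : Fintype.card V = 8)
    (hs : Strong D) (hN : CoRegular D) :
    ∃ v v' u u' r r' x x', TwinCycle D v v' u u' r r' x x' := by
  choose σ hσ hadj using exists_adj_forall_adj_iff_nonAdj hD hV hN
  obtain ⟨v, hv⟩ := exists_iterate_four_eq hD hV hs hN hσ hadj
  have key : ∀ v, ∃ t, σ (σ v) ≠ t ∧ ∀ w, NonAdj D v w ↔ w = σ (σ v) ∨ w = t := by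
    intro v
    obtain ⟨a, b, hab, h⟩ := hN v
    rcases (h _).1 ((hadj v _).1 (hσ (σ v))) with e | e
    · exact ⟨b, e ▸ hab, fun w => by rw [h, e]⟩
    · exact ⟨a, e ▸ hab.symm, fun w => by rw [h, e, or_comm]⟩
  obtain ⟨r', hr, hv'⟩ := key v
  obtain ⟨x', hx, hu'⟩ := key (σ v)
  obtain ⟨v', hv₁, hr'⟩ := key (σ (σ v))
  obtain ⟨u', hu₁, hx'⟩ := key (σ (σ (σ v)))
  rw [hv] at hu₁ hx' hv₁ hr'
  refine ⟨v, v', σ v, u', σ (σ v), r', σ (σ (σ v)), x', hv₁, hu₁, hr, hx, fun w => ?_,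
    fun w => ?_, fun w => ?_, fun w => ?_, hv', hu', hr', hx'⟩
  · conv_lhs => rw [← hv]
    rw [hadj, hx']
  · rw [hadj, hv']
  · rw [hadj, hu']
  · rw [hadj, hr']

/-- A map between digraphs of equal order that preserves arcs and non-adjacency is an isomorphism, if
the target has no `2`-cycles: injectivity follows because distinct vertices are sent to vertices that
are joined by an arc or non-adjacent. -/
lemma nonempty_relIso_of_adj_of_nonAdj {W : Type*} [Fintype V] [Fintype W] {E : Digraph W}
    (hD : ∀ a b, D.Adj a b → ¬ D.Adj b a) (hcard : Fintype.card W = Fintype.card V) (f : W → V)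
    (hadj : ∀ a b, E.Adj a b → D.Adj (f a) (f b))
    (hnon : ∀ a b, NonAdj E a b → NonAdj D (f a) (f b)) : Nonempty (D.Adj ≃r E.Adj) := by
  have htri : ∀ a b, a = b ∨ E.Adj a b ∨ E.Adj b a ∨ NonAdj E a b := by
    intro a b; unfold NonAdj; tauto
  have hinj : Function.Injective f := by
    intro a b hab
    rcases htri a b with h | h | h | h
    · exact h
    · have := hadj _ _ h; rw [hab] at this; exact absurd this (hD _ _ this)
    · have := hadj _ _ h; rw [hab] at this; exact absurd this (hD _ _ this)
    · exact absurd hab.symm (hnon _ _ h).1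
  have hbij := (Fintype.bijective_iff_injective_and_card f).2 ⟨hinj, hcard⟩
  refine ⟨RelIso.symm ⟨Equiv.ofBijective f hbij, ?_⟩⟩
  intro a b
  refine ⟨fun h => ?_, hadj a b⟩
  rw [Equiv.ofBijective_apply, Equiv.ofBijective_apply] at h
  rcases htri a b with h' | h' | h' | h'
  · subst h'; exact absurd h (hD _ _ h)
  · exact h'
  · exact absurd h (hD _ _ (hadj _ _ h'))
  · exact absurd h (hnon _ _ h').2.1

instance : DecidableRel F8.Adj := fun a b => by unfold F8; infer_instance

instance (a b : ZMod 8) : Decidable (NonAdj F8 a b) := by unfold NonAdj; infer_instance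

lemma TwinCycle.nonempty_relIso_F8 [Fintype V] {v v' u u' r r' x x' : V}
    (h : TwinCycle D v v' u u' r r' x x')
    (hD : Admissible D) (hN : CoRegular D) (hV : Fintype.card V = 8) :
    Nonempty (D.Adj ≃r F8.Adj) := by
  have hu := h.rotate
  have hr := hu.rotate
  have hx := hr.rotate
  -- In `F8` the pairs `{v₀, v₁}`, `{v₂, v₃}`, … are the twins, each with its arc `v₂ᵢ → v₂ᵢ₊₁`.
  let f : ZMod 8 → V := (![v', v, u', u, r', r, x', x] : Fin 8 → V)
  refine nonempty_relIso_of_adj_of_nonAdj hD.asymm (by rw [hV]; rfl) f ?_ ?_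
  · have key : ∀ a b : ZMod 8, F8.Adj a b → (a, b) ∈ ([(0, 1), (0, 2), (0, 3), (1, 2), (1, 3),
        (2, 3), (2, 4), (2, 5), (3, 4), (3, 5), (4, 5), (4, 6), (4, 7), (5, 6), (5, 7),
        (6, 7), (6, 0), (6, 1), (7, 0), (7, 1)] : List (ZMod 8 × ZMod 8)) := by decide
    intro a b hab
    have hab := key a b hab
    simp only [List.mem_cons, List.not_mem_nil, or_false, Prod.mk.injEq] at hab
    rcases hab with ⟨rfl, rfl⟩ | ⟨rfl, rfl⟩ | ⟨rfl, rfl⟩ | ⟨rfl, rfl⟩ | ⟨rfl, rfl⟩ | ⟨rfl, rfl⟩ |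
      ⟨rfl, rfl⟩ | ⟨rfl, rfl⟩ | ⟨rfl, rfl⟩ | ⟨rfl, rfl⟩ | ⟨rfl, rfl⟩ | ⟨rfl, rfl⟩ | ⟨rfl, rfl⟩ |
      ⟨rfl, rfl⟩ | ⟨rfl, rfl⟩ | ⟨rfl, rfl⟩ | ⟨rfl, rfl⟩ | ⟨rfl, rfl⟩ | ⟨rfl, rfl⟩ | ⟨rfl, rfl⟩
    exacts [h.twin_adj_self hD, h.twin_adj_twin hD hN, h.twin_adj_next hD,
      (h.outs_v _).2 (Or.inr rfl), (h.outs_v _).2 (Or.inl rfl),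
      hu.twin_adj_self hD, hu.twin_adj_twin hD hN, hu.twin_adj_next hD,
      (hu.outs_v _).2 (Or.inr rfl), (hu.outs_v _).2 (Or.inl rfl),
      hr.twin_adj_self hD, hr.twin_adj_twin hD hN, hr.twin_adj_next hD,
      (hr.outs_v _).2 (Or.inr rfl), (hr.outs_v _).2 (Or.inl rfl),
      hx.twin_adj_self hD, hx.twin_adj_twin hD hN, hx.twin_adj_next hD,
      (hx.outs_v _).2 (Or.inr rfl), (hx.outs_v _).2 (Or.inl rfl)]
  · have key : ∀ a b : ZMod 8, NonAdj F8 a b → (a, b) ∈ ([(0, 4), (0, 5), (1, 4), (1, 5),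
        (2, 6), (2, 7), (3, 6), (3, 7)] : List (ZMod 8 × ZMod 8)) ∨
        (b, a) ∈ ([(0, 4), (0, 5), (1, 4), (1, 5),
        (2, 6), (2, 7), (3, 6), (3, 7)] : List (ZMod 8 × ZMod 8)) := by decide
    suffices H : ∀ a b : ZMod 8, (a, b) ∈ ([(0, 4), (0, 5), (1, 4), (1, 5),
        (2, 6), (2, 7), (3, 6), (3, 7)] : List (ZMod 8 × ZMod 8)) → NonAdj D (f a) (f b) by
      intro a b hab
      rcases key a b hab with h' | h'
      exacts [H _ _ h', (H _ _ h').symm]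
    intro a b hab
    simp only [List.mem_cons, List.not_mem_nil, or_false, Prod.mk.injEq] at hab
    rcases hab with ⟨rfl, rfl⟩ | ⟨rfl, rfl⟩ | ⟨rfl, rfl⟩ | ⟨rfl, rfl⟩ | ⟨rfl, rfl⟩ | ⟨rfl, rfl⟩ |
      ⟨rfl, rfl⟩ | ⟨rfl, rfl⟩
    exacts [h.nonAdj_twin_twin hD, ((h.nons_r _).2 (Or.inr rfl)).symm,
      (h.nons_v _).2 (Or.inr rfl), (h.nons_v _).2 (Or.inl rfl),
      hu.nonAdj_twin_twin hD, ((hu.nons_r _).2 (Or.inr rfl)).symm,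
      (hu.nons_v _).2 (Or.inr rfl), (hu.nons_v _).2 (Or.inl rfl)]

/-! ### Members of the family -/

lemma hasDirectedCycle_two {a b : V} (hab : D.Adj a b) (hba : D.Adj b a) (hne : a ≠ b) :
    HasDirectedCycle D 2 := by
  refine ⟨(![a, b] : Fin 2 → V), ?_, ?_⟩
  · intro i j hij
    fin_cases i <;> fin_cases j <;> first | rfl | exact absurd hij hne | exact absurd hij hne.symm
  · intro i
    fin_cases i
    exacts [hab, hba]

lemma hasDirectedCycle_three {a b c : V} (hab : D.Adj a b) (hbc : D.Adj b c) (hca : D.Adj c a)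
    (h1 : a ≠ b) (h2 : b ≠ c) (h3 : c ≠ a) : HasDirectedCycle D 3 := by
  refine ⟨(![a, b, c] : Fin 3 → V), ?_, ?_⟩
  · intro i j hij
    fin_cases i <;> fin_cases j <;> first
      | rfl | exact absurd hij h1 | exact absurd hij h1.symm | exact absurd hij h2
      | exact absurd hij h2.symm | exact absurd hij h3 | exact absurd hij h3.symm
  · intro i
    fin_cases i
    exacts [hab, hbc, hca]

lemma InFamily.admissible (h : InFamily 8 3 2 1 D) : Admissible D where
  asymm a b hab hba := h.cycleFree 2 le_rfl (by norm_num)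
    (hasDirectedCycle_two hab hba (by rintro rfl; exact h.loopless _ hab))
  no_triangle a b c hab hbc hca := h.cycleFree 3 (by norm_num) le_rfl
    (hasDirectedCycle_three hab hbc hca (by rintro rfl; exact h.loopless _ hab)
      (by rintro rfl; exact h.loopless _ hbc) (by rintro rfl; exact h.loopless _ hca))
  two_out v := by
    have := h.finite
    obtain ⟨a, ha, b, hb, hab⟩ := (Set.one_lt_ncard (Set.toFinite _)).1 (h.le_outDegree v)
    exact ⟨a, b, hab, ha, hb⟩
  one_in v := by
    have := h.finite
    exact (Set.ncard_pos (Set.toFinite _)).1 (h.le_inDegree v)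

lemma sum_card_outs [Fintype V] (D : Digraph V) : ∑ v, (outs D v).card = size D := by
  classical
  have : {p : V × V | D.Adj p.1 p.2} =
      ((Finset.univ.sigma fun v => outs D v).map (Equiv.sigmaEquivProd V V).toEmbedding :
        Set (V × V)) := by
    ext ⟨a, b⟩; simp
  rw [size, this, Set.ncard_coe_finset, Finset.card_map, Finset.card_sigma]

lemma sum_card_ins [Fintype V] (D : Digraph V) : ∑ v, (ins D v).card = size D := by
  classical
  rw [← sum_card_outs]
  exact (Finset.sum_card_bipartiteAbove_eq_sum_card_bipartiteBelow
    (s := .univ) (t := .univ) D.Adj).symm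

lemma InFamily.two_mul_size_add_sum_card_nons [Fintype V] (h : InFamily 8 3 2 1 D) :
    2 * size D + ∑ v, (nons D v).card = 56 := by
  have hV : Fintype.card V = 8 := by rw [← Nat.card_eq_fintype_card]; exact h.card_eq
  have := Finset.sum_congr rfl fun v (_ : v ∈ Finset.univ) =>
    card_outs_add_card_ins_add_card_nons h.admissible hV v
  rw [Finset.sum_add_distrib, Finset.sum_add_distrib, sum_card_outs, sum_card_ins,
    Finset.sum_const, Finset.card_univ, hV, smul_eq_mul] at this
  omega

lemma InFamily.size_le (h : InFamily 8 3 2 1 D) : size D ≤ 20 := by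
  have := h.finite
  have := Fintype.ofFinite V
  have hV : Fintype.card V = 8 := by rw [← Nat.card_eq_fintype_card]; exact h.card_eq
  have h1 := h.two_mul_size_add_sum_card_nons
  have h2 : ∑ _v : V, 2 ≤ ∑ v, (nons D v).card :=
    Finset.sum_le_sum fun v _ => two_le_card_nons h.admissible hV h.strong v
  rw [Finset.sum_const, Finset.card_univ, hV, smul_eq_mul] at h2
  omega

lemma InFamily.nonempty_relIso_F8 (h : InFamily 8 3 2 1 D) (hsize : size D = 20) :
    Nonempty (D.Adj ≃r F8.Adj) := by
  classical
  have := h.finite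
  have := Fintype.ofFinite V
  have hV : Fintype.card V = 8 := by rw [← Nat.card_eq_fintype_card]; exact h.card_eq
  have h1 := h.two_mul_size_add_sum_card_nons
  have h2 := (Finset.sum_eq_sum_iff_of_le (s := .univ) (f := fun _ : V => 2)
    fun v _ => two_le_card_nons h.admissible hV h.strong v).1 (by
      rw [Finset.sum_const, Finset.card_univ, hV, smul_eq_mul]; omega)
  have hN : CoRegular D := by
    intro v
    obtain ⟨a, b, hab, hv⟩ := Finset.card_eq_two.1 (h2 v (Finset.mem_univ v)).symm
    refine ⟨a, b, hab, fun w => ?_⟩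
    rw [← mem_nons, hv, Finset.mem_insert, Finset.mem_singleton]
  obtain ⟨v, v', u, u', r, r', x, x', ht⟩ := exists_twinCycle h.admissible hV h.strong hN
  exact ht.nonempty_relIso_F8 h.admissible hN hV

/-! ### The digraph `F8` and the extremal value -/

lemma size_F8 : size F8 = 20 := by
  have : {p : ZMod 8 × ZMod 8 | F8.Adj p.1 p.2} =
      ((Finset.univ.filter fun p : ZMod 8 × ZMod 8 => F8.Adj p.1 p.2 : Finset _) : Set _) := by
    ext; simp
  rw [size, this, Set.ncard_coe_finset]
  rfl

lemma strong_F8 : Strong F8 := by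
  have hstep : ∀ a : ZMod 8, F8.Adj a (a + 1) := by decide
  have key : ∀ (n : ℕ) (a : ZMod 8), Relation.ReflTransGen F8.Adj a (a + n) := by
    intro n a
    induction n with
    | zero => simpa using Relation.ReflTransGen.refl
    | succ n ih =>
      have := ih.tail (hstep _)
      rwa [add_assoc, ← Nat.cast_succ] at this
  intro a b
  have := key (b - a).val a
  rwa [ZMod.natCast_zmod_val, add_sub_cancel] at this

lemma cycleFree_F8 : CycleFree 3 F8 := by
  intro l h2 h3
  interval_cases l
  · rintro ⟨y, -, hy⟩
    have key : ∀ a b : ZMod 8, F8.Adj a b → ¬ F8.Adj b a := by decide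
    exact key _ _ (hy 0) (hy 1)
  · rintro ⟨y, -, hy⟩
    have key : ∀ a b : ZMod 8, F8.Adj a b → ∀ c, F8.Adj b c → ¬ F8.Adj c a := by decide
    exact key _ _ (hy 0) _ (hy 1) (hy 2)

lemma inFamily_F8 : InFamily 8 3 2 1 F8 where
  finite := inferInstanceAs (Finite (Fin 8))
  card_eq := Nat.card_zmod 8
  loopless := by decide
  strong := strong_F8
  cycleFree := cycleFree_F8
  le_outDegree v := by
    have key : ∀ v : ZMod 8, ∃ a b, F8.Adj v a ∧ F8.Adj v b ∧ a ≠ b := by decide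
    obtain ⟨a, b, ha, hb, hab⟩ := key v
    exact (Set.one_lt_ncard (Set.toFinite _)).2 ⟨a, ha, b, hb, hab⟩
  le_inDegree v := by
    have key : ∀ v : ZMod 8, ∃ a, F8.Adj a v := by decide
    exact (Set.ncard_pos (Set.toFinite _)).2 (key v)

lemma maxSize_eq : maxSize 8 3 2 1 = 20 := by
  refine IsGreatest.csSup_eq ⟨⟨F8, inFamily_F8, size_F8⟩, ?_⟩
  rintro m ⟨D, hD, rfl⟩
  exact hD.size_le

end ExtremalDigraph

theorem lemma2p5 :
    (∀ (V : Type*) (D : Digraph V), ExtremalDigraph.IsExtremal 8 3 2 1 D →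
      Nonempty (D.Adj ≃r ExtremalDigraph.F8.Adj)) ∧
    ExtremalDigraph.IsExtremal 8 3 2 1 ExtremalDigraph.F8 ∧
    ExtremalDigraph.size ExtremalDigraph.F8 = 20 := by
  refine ⟨fun V D h => ?_, ⟨ExtremalDigraph.inFamily_F8, ?_⟩, ExtremalDigraph.size_F8⟩
  · exact h.1.nonempty_relIso_F8 (h.2.trans ExtremalDigraph.maxSize_eq)
  · rw [ExtremalDigraph.size_F8, ExtremalDigraph.maxSize_eq]
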